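/- Let $A,B$ be positive semidefinite operators on a finite-dimensional complex Hilbert space and let $\alpha>1$. For $\gamma\ge 0$ put $E_\gamma(A\|B)=\operatorname{Tr}[(A-\gamma B)_+]$, where $X_+$ is the positive part of a Hermitian operator $X$, and define in $(-\infty,+\infty]$ $$H_\alpha(A\|B)=\operatorname{Tr}[A-B]+\alpha\int_1^\infty\Big(\gamma^{\alpha-2}E_\gamma(A\|B)+\gamma^{-\alpha-1}E_\gamma(B\|A)\Big)\,d\gamma ,\qquad Q_\alpha(A\|B)=1+(\alpha-1)H_\alpha(A\|B).$$ For $t>0$ the operator $A(B+t\mathbf 1)^{-1}$ is diagonalizable with nonnegative eigenvalues, and its power $(A(B+t\mathbf 1)^{-1})^\alpha$ is the one with the same eigenvectors and the eigenvalues raised to the power $\alpha$. For all $t>0$ the traces $\operatorname{Tr}[(A(B+t\mathbf 1)^{-1})^\alpha]$ and $\operatorname{Tr}[((B+t\mathbf 1)^{-1/2}A(B+t\mathbf 1)^{-1/2})^\alpha]$ are nonnegative real numbers, and, as identities in $(-\infty,+\infty]$, $$H_\alpha(A\|B)=-\frac{1}{\alpha-1}\operatorname{Tr}[A]+\int_0^\infty\operatorname{Tr}\Big[\big(A(B+t\mathbf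 1)^{-1}\big)^{\alpha}\Big]\,dt ,$$ $$Q_\alpha(A\|B)=1-\operatorname{Tr}[A]+(\alpha-1)\int_0^\infty\operatorname{Tr}\Big[\big((B+t\mathbf 1)^{-1/2}A(B+t\mathbf 1)^{-1/2}\big)^{\alpha}\Big]\,dt .$$ In particular, if $\operatorname{Tr}[A]=1$ (for instance if $A$ and $B$ are quantum states), then $$Q_\alpha(A\|B)=(\alpha-1)\int_0^\infty\operatorname{Tr}\Big[\big((B+t\mathbf 1)^{-1/2}A(B+t\mathbf 1)^{-1/2}\big)^{\alpha}\Big]\,dt .$$ If the support of $A$ is contained in the support of $B$, then $\int_0^\infty\operatorname{Tr}[(A(B+t\mathbf 1)^{-1})^\alpha]\,dt<\infty$, so that all these quantities are finite. -/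

import Mathlib

open scoped ComplexOrder

namespace QuantumRenyi

noncomputable section

variable {n : Type*} [Fintype n] [DecidableEq n]

/-- The quantum hockey-stick divergence `E_γ(A‖B) = Tr[(A - γ B)₊]`, where `X₊` is the positive
part of a Hermitian matrix in the sense of functional calculus. -/
def hockeyStick (γ : ℝ) (A B : Matrix n n ℂ) : ℝ :=
  (A - (γ : ℂ) • B)⁺.trace.re

/-- The Hellinger divergence of positive semidefinite matrices,
`H_α(A‖B) = Tr[A - B] + α ∫_1^∞ (γ^(α-2) E_γ(A‖B) + γ^(-α-1) E_γ(B‖A)) dγ`.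
The integrand is nonnegative, so the integral always exists in `[0, ∞]`. -/
def hellinger (α : ℝ) (A B : Matrix n n ℂ) : EReal :=
  (((A - B).trace.re : ℝ) : EReal) +
    ((ENNReal.ofReal α * ∫⁻ γ in Set.Ioi (1 : ℝ),
      ENNReal.ofReal
        (γ ^ (α - 2) * hockeyStick γ A B + γ ^ (-α - 1) * hockeyStick γ B A) : ENNReal) : EReal)

/-- The quasi Rényi divergence `Q_α(A‖B) = 1 + (α - 1) H_α(A‖B)`. -/
def quasiRenyi (α : ℝ) (A B : Matrix n n ℂ) : EReal :=
  1 + ((α - 1 : ℝ) : EReal) * hellinger α A B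

/-- The matrix function `f(X)` of a diagonalizable, not necessarily normal, complex matrix:
`f(X) = p(X)` for the polynomial `p` interpolating `f` at the distinct eigenvalues of `X`.
Thus `f(S diag(d) S⁻¹) = S diag(f(d)) S⁻¹`. -/
def diagonalizableFun (f : ℂ → ℂ) (X : Matrix n n ℂ) : Matrix n n ℂ :=
  Polynomial.aeval X (Lagrange.interpolate X.charpoly.roots.toFinset id f)

/-- The power `X ^ α` of a diagonalizable matrix with nonnegative eigenvalues. It is applied to
`X = A (B + t 1)⁻¹`, which is similar to the positive semidefinite matrix
`(B + t 1)^(-1/2) A (B + t 1)^(-1/2)`. -/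
def diagonalizableRpow (X : Matrix n n ℂ) (α : ℝ) : Matrix n n ℂ :=
  diagonalizableFun (fun z => z ^ (α : ℂ)) X

/-- The power `X ^ α` of a positive semidefinite matrix, by functional calculus. -/
def psdRpow (X : Matrix n n ℂ) (α : ℝ) : Matrix n n ℂ :=
  cfc (fun x : ℝ => x ^ α) X

/-- `(A (B + t 1)⁻¹)^α`. -/
def quotientPow (α : ℝ) (A B : Matrix n n ℂ) (t : ℝ) : Matrix n n ℂ :=
  diagonalizableRpow (A * (B + (t : ℂ) • (1 : Matrix n n ℂ))⁻¹) α

/-- `((B + t 1)^(-1/2) A (B + t 1)^(-1/2))^α`. -/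
def symmQuotientPow (α : ℝ) (A B : Matrix n n ℂ) (t : ℝ) : Matrix n n ℂ :=
  psdRpow (psdRpow (B + (t : ℂ) • (1 : Matrix n n ℂ)) (-1 / 2) * A *
    psdRpow (B + (t : ℂ) • (1 : Matrix n n ℂ)) (-1 / 2)) α

/-- `A ≪ B`: the support of `A` (the orthogonal complement of its kernel) is contained in the
support of `B`. -/
def SuppLE (A B : Matrix n n ℂ) : Prop :=
  LinearMap.ker B.mulVecLin ≤ LinearMap.ker A.mulVecLin

end

end QuantumRenyi

/-!
For `t > 0` put `M_t = (B + t)^(-1/2) A (B + t)^(-1/2)`. The matrix `A (B + t)⁻¹` is similar to `M_t`,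
so both traces in the theorem equal `∑ i, μ_i(t) ^ α`, the sum over the eigenvalues of `M_t`
(`trace_quotientPow`, `trace_symmQuotientPow`).

The heart of the argument is a count of eigenvalues. Since
`A - γ B - γ t = (B + t)^(1/2) (M_t - γ) (B + t)^(1/2)`, Sylvester's law of inertia says that `M_t` has
as many eigenvalues above `γ` as `A - γ B` has above `γ t` (`card_eigenvalues_symmQuotient`). Writing
this number as `N(t, γ)`, the layer cake formula gives
`E_γ(A‖B) = γ ∫_0^∞ N(t, γ) dt` and `Tr (M_t ^ α) = ∫_0^∞ α γ^(α-1) N(t, γ) dγ`, and Tonelli's theorem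
yields `∫_0^∞ Tr (M_t ^ α) dt = α ∫_0^∞ γ^(α-2) E_γ(A‖B) dγ`
(`lintegral_trace_symmQuotientPow`). Joint measurability of `N` is obtained from the sorted
eigenvalues of `A - γ B`, which are antitone in `γ`.

On `(0, 1)` the substitution `γ = 1/s` together with
`E_{1/s}(A‖B) = Tr A - s⁻¹ Tr B + s⁻¹ E_s(B‖A)`, which is `X₊ - X₋ = X`, turns the integral into
`α ∫_1^∞ s^(-α-1) E_s(B‖A) ds` plus elementary terms (`lintegral_Ioo_hockeyStick_add`); all of these
are finite, so the identity survives the possible value `∞` of the remaining integral over `(1, ∞)`.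
If the support of `A` lies in that of `B`, then `A ≤ c B` for some `c`
(`exists_posSemidef_smul_sub`), hence `E_γ(A‖B) = 0` for `γ ≥ c`, and that integral is finite too.
-/

namespace QuantumRenyi

open Matrix Finset MeasureTheory
open scoped ENNReal

/-! ### Functions of diagonalizable matrices and eigenvalue counts -/

section LinearAlgebra

variable {n : Type*} [Fintype n] [DecidableEq n]

theorem aeval_conj_diagonal (S T : Matrix n n ℂ) (hTS : T * S = 1) (d : n → ℂ)
    (p : Polynomial ℂ) :
    Polynomial.aeval (S * diagonal d * T) p = S * diagonal (fun i => p.eval (d i)) * T := by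
  have hST : S * T = 1 := mul_eq_one_comm.mp hTS
  obtain ⟨X, hX⟩ : ∃ X, X = S * diagonal d * T := ⟨_, rfl⟩
  rw [← hX]
  have hpow : ∀ k : ℕ, X ^ k = S * diagonal (fun i => d i ^ k) * T := fun k => by
    induction k with
    | zero => simp [hST]
    | succ k ih =>
      calc X ^ (k + 1) = S * diagonal (fun i => d i ^ k) * (T * S) * diagonal d * T := by
            rw [pow_succ, ih, hX]; simp only [mul_assoc]
        _ = S * (diagonal (fun i => d i ^ k) * diagonal d) * T := by
            rw [hTS, mul_one, mul_assoc S]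
        _ = _ := by rw [diagonal_mul_diagonal]; simp only [pow_succ]
  have hdiag : diagonal (fun i => p.eval (d i)) =
      ∑ k ∈ range (p.natDegree + 1), p.coeff k • diagonal (fun i => d i ^ k) := by
    ext i j
    by_cases hij : i = j
    · subst hij
      simp [Matrix.sum_apply, Polynomial.eval_eq_sum_range]
    · simp [Matrix.sum_apply, hij]
  rw [Polynomial.aeval_eq_sum_range, hdiag, mul_sum, sum_mul]
  refine sum_congr rfl fun k _ => ?_
  rw [hpow, mul_smul_comm, smul_mul_assoc]

theorem trace_diagonalizableFun (f : ℂ → ℂ) (S T : Matrix n n ℂ) (hTS : T * S = 1) (d : n → ℂ) :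
    (diagonalizableFun f (S * diagonal d * T)).trace = ∑ i, f (d i) := by
  have hchar : (S * diagonal d * T).charpoly = (diagonal d).charpoly := by
    rw [charpoly_mul_comm, ← mul_assoc, hTS, one_mul]
  rw [diagonalizableFun, hchar, aeval_conj_diagonal S T hTS, trace_mul_comm, ← mul_assoc, hTS,
    one_mul, trace_diagonal]
  refine sum_congr rfl fun i _ => ?_
  refine Lagrange.eval_interpolate_at_node (v := id) f Function.injective_id.injOn (i := d i) ?_
  rw [Multiset.mem_toFinset, charpoly_diagonal, Polynomial.roots_prod _ _
    (prod_ne_zero_iff.mpr fun i _ => Polynomial.X_sub_C_ne_zero _)]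
  simp

theorem eq_unitary_conj {H : Matrix n n ℂ} (hH : H.IsHermitian) :
    H = (hH.eigenvectorUnitary : Matrix n n ℂ) * diagonal (fun i => (hH.eigenvalues i : ℂ)) *
      star (hH.eigenvectorUnitary : Matrix n n ℂ) :=
  hH.spectral_theorem

theorem cfc_eq_unitary_conj {H : Matrix n n ℂ} (hH : H.IsHermitian) (f : ℝ → ℝ) :
    cfc f H = (hH.eigenvectorUnitary : Matrix n n ℂ) *
      diagonal (fun i => (f (hH.eigenvalues i) : ℂ)) *
      star (hH.eigenvectorUnitary : Matrix n n ℂ) := by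
  rw [hH.cfc_eq]; rfl

theorem trace_cfc {H : Matrix n n ℂ} (hH : H.IsHermitian) (f : ℝ → ℝ) :
    (cfc f H).trace = ((∑ i, f (hH.eigenvalues i) : ℝ) : ℂ) := by
  rw [cfc_eq_unitary_conj hH, trace_mul_comm, ← mul_assoc, Unitary.coe_star_mul_self, one_mul,
    trace_diagonal]
  simp

theorem trace_posPart {H : Matrix n n ℂ} (hH : H.IsHermitian) :
    (H⁺).trace.re = ∑ i, max (hH.eigenvalues i) 0 := by
  rw [CFC.posPart_def, cfcₙ_eq_cfc (hf := by fun_prop) (hf0 := by simp), trace_cfc hH,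
    Complex.ofReal_re]
  rfl

theorem dotProduct_sub_smul_one {H : Matrix n n ℂ} (hH : H.IsHermitian) (c : ℝ) (x : n → ℂ) :
    star x ⬝ᵥ (H - (c : ℂ) • (1 : Matrix n n ℂ)) *ᵥ x =
      ((∑ i, (hH.eigenvalues i - c) *
        ‖(star (hH.eigenvectorUnitary : Matrix n n ℂ) *ᵥ x) i‖ ^ 2 : ℝ) : ℂ) := by
  set U := (hH.eigenvectorUnitary : Matrix n n ℂ) with hU
  have h1 : H - (c : ℂ) • (1 : Matrix n n ℂ) =
      U * diagonal (fun i => ((hH.eigenvalues i - c : ℝ) : ℂ)) * star U := by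
    have hc : (c : ℂ) • (1 : Matrix n n ℂ) = U * diagonal (fun _ => (c : ℂ)) * star U := by
      rw [← smul_one_eq_diagonal]
      simp [hU]
    conv_lhs => rw [eq_unitary_conj hH, hc, ← hU, ← sub_mul, ← mul_sub, diagonal_sub]
    simp
  rw [h1, ← mulVec_mulVec, ← mulVec_mulVec, dotProduct_mulVec]
  have h2 : star x ᵥ* U = star (star U *ᵥ x) := by
    rw [star_mulVec, star_eq_conjTranspose, conjTranspose_conjTranspose]
  rw [h2]
  simp only [dotProduct, mulVec_diagonal, Complex.ofReal_sum]
  refine sum_congr rfl fun i _ => ?_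
  rw [Pi.star_apply, Complex.star_def, mul_left_comm, Complex.conj_mul']
  simp [star_eq_conjTranspose]

omit [DecidableEq n] in
/-- Sylvester's law of inertia for diagonal forms, as an inequality. If `d` is dominated by the
pullback of `e` along `T`, then on the span of the coordinates with `0 < d i` the map `T` followed by
the restriction to the coordinates with `0 < e i` is injective. -/
theorem card_pos_le_of_form_le (d e : n → ℝ) (T : (n → ℂ) →ₗ[ℂ] (n → ℂ))
    (h : ∀ a, ∑ i, d i * ‖a i‖ ^ 2 ≤ ∑ i, e i * ‖T a i‖ ^ 2) :
    #{i | 0 < d i} ≤ #{i | 0 < e i} := by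
  classical
  let E : ({i // 0 < d i} → ℂ) →ₗ[ℂ] (n → ℂ) := Function.ExtendByZero.linearMap ℂ Subtype.val
  let L : ({i // 0 < d i} → ℂ) →ₗ[ℂ] ({i // 0 < e i} → ℂ) :=
    LinearMap.funLeft ℂ ℂ Subtype.val ∘ₗ T ∘ₗ E
  have hL : Function.Injective L := by
    rw [injective_iff_map_eq_zero]
    intro a ha
    have hE : ∀ i : {i // 0 < d i}, E a i = a i := fun i =>
      Subtype.val_injective.extend_apply _ _ _
    have hE0 : ∀ i, ¬ 0 < d i → E a i = 0 := fun i hi => by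
      refine Function.extend_apply' _ _ _ ?_
      rintro ⟨j, rfl⟩
      exact hi j.2
    have hle : ∑ i, d i * ‖E a i‖ ^ 2 ≤ 0 := by
      refine (h (E a)).trans (sum_nonpos fun i _ => ?_)
      by_cases hi : 0 < e i
      · have : T (E a) i = 0 := congrFun ha ⟨i, hi⟩
        simp [this]
      · exact mul_nonpos_of_nonpos_of_nonneg (not_lt.mp hi) (by positivity)
    have hnn : ∀ i ∈ univ, 0 ≤ d i * ‖E a i‖ ^ 2 := fun i _ => by
      by_cases hi : 0 < d i
      · positivity
      · simp [hE0 i hi]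
    have hz := (sum_eq_zero_iff_of_nonneg hnn).mp (hle.antisymm (sum_nonneg hnn))
    ext i
    have := hz i (mem_univ _)
    rw [hE] at this
    simpa [i.2.ne'] using this
  have := LinearMap.finrank_le_finrank_of_injective hL
  simpa [Fintype.card_subtype] using this

/-- If `H - c ≤ Rᴴ (K - d) R`, then `K` has at least as many eigenvalues above `d` as `H` has
above `c`. With `R` invertible and equality this gives the law of inertia, with `R = 1` and `c = d`
the monotonicity of eigenvalues. -/
theorem card_eigenvalues_le {H K : Matrix n n ℂ} (hH : H.IsHermitian) (hK : K.IsHermitian)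
    (R : Matrix n n ℂ) (c d : ℝ)
    (h : (Rᴴ * (K - (d : ℂ) • (1 : Matrix n n ℂ)) * R -
      (H - (c : ℂ) • (1 : Matrix n n ℂ))).PosSemidef) :
    #{i | c < hH.eigenvalues i} ≤ #{i | d < hK.eigenvalues i} := by
  have key := card_pos_le_of_form_le (fun i => hH.eigenvalues i - c) (fun i => hK.eigenvalues i - d)
    (Matrix.toLin' (star (hK.eigenvectorUnitary : Matrix n n ℂ) * R *
      (hH.eigenvectorUnitary : Matrix n n ℂ))) ?_
  · simpa using key
  intro a
  set x := (hH.eigenvectorUnitary : Matrix n n ℂ) *ᵥ a with hx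
  have hxa : star (hH.eigenvectorUnitary : Matrix n n ℂ) *ᵥ x = a := by
    rw [hx, mulVec_mulVec, Unitary.coe_star_mul_self, one_mulVec]
  have h1 := h.dotProduct_mulVec_nonneg x
  rw [sub_mulVec, dotProduct_sub, dotProduct_sub_smul_one hH, hxa, ← mulVec_mulVec,
    ← mulVec_mulVec, dotProduct_mulVec, ← star_mulVec, dotProduct_sub_smul_one hK, sub_nonneg,
    Complex.real_le_real] at h1
  simpa [hx, mulVec_mulVec, mul_assoc] using h1

theorem sum_eigenvalues_eq {M : Type*} [AddCommMonoid M] {H : Matrix n n ℂ} (hH : H.IsHermitian)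
    (f : ℝ → M) : ∑ i, f (hH.eigenvalues i) = ∑ k, f (hH.eigenvalues₀ k) :=
  Equiv.sum_comp (Fintype.equivOfCardEq (Fintype.card_fin _)).symm fun k => f (hH.eigenvalues₀ k)

/-- Weyl monotonicity: the sorted eigenvalues are monotone in the Loewner order. -/
theorem eigenvalues₀_le {H K : Matrix n n ℂ} (hH : H.IsHermitian) (hK : K.IsHermitian)
    (h : (K - H).PosSemidef) (k : Fin (Fintype.card n)) :
    hH.eigenvalues₀ k ≤ hK.eigenvalues₀ k := by
  by_contra! hlt
  set c := hK.eigenvalues₀ k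
  have hcard : #{i | c < hH.eigenvalues₀ i} ≤ #{i | c < hK.eigenvalues₀ i} := by
    have := card_eigenvalues_le hH hK 1 c c (by simpa using h)
    simp only [card_filter] at this ⊢
    rwa [sum_eigenvalues_eq hH fun x => if c < x then 1 else 0,
      sum_eigenvalues_eq hK fun x => if c < x then 1 else 0] at this
  -- Above `c` lie at least `k + 1` eigenvalues of `H` and at most `k` eigenvalues of `K`.
  have h1 : Finset.Iic k ⊆ ({i | c < hH.eigenvalues₀ i} : Finset _) := fun i hi => by
    simpa using hlt.trans_le (hH.eigenvalues₀_antitone (Finset.mem_Iic.mp hi))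
  have h2 : ({i | c < hK.eigenvalues₀ i} : Finset _) ⊆ Finset.Iio k := fun i hi => by
    by_contra hik
    have := hK.eigenvalues₀_antitone (not_lt.mp (by simpa using hik))
    exact absurd (by simpa using hi) (not_lt.mpr this)
  have := (card_le_card h1).trans (hcard.trans (card_le_card h2))
  simp at this

end LinearAlgebra

/-! ### The symmetrized quotient and the pencil `A - γ B` -/

section Pencil

variable {n : Type*} [Fintype n] [DecidableEq n]

omit [Fintype n] in
theorem posDef_add_smul_one {B : Matrix n n ℂ} (hB : B.PosSemidef) {t : ℝ} (ht : 0 < t) :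
    (B + (t : ℂ) • (1 : Matrix n n ℂ)).PosDef :=
  PosDef.posSemidef_add hB (PosDef.one.smul (by exact_mod_cast ht))

/-- `psdRpow K (-1 / 2)` is Hermitian and inverse to a Hermitian square root `S` of `K`. -/
theorem exists_sqrt_inverse_psdRpow {K : Matrix n n ℂ} (hK : K.PosDef) :
    ∃ S : Matrix n n ℂ, Sᴴ = S ∧ S * S = K ∧ (psdRpow K (-1 / 2))ᴴ = psdRpow K (-1 / 2) ∧
      psdRpow K (-1 / 2) * S = 1 := by
  have hH := hK.isHermitian
  set U := (hH.eigenvectorUnitary : Matrix n n ℂ) with hU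
  have hUU : star U * U = 1 := Unitary.coe_star_mul_self _
  have hUU' : U * star U = 1 := Unitary.coe_mul_star_self _
  have hadj : ∀ f : n → ℝ, (U * diagonal (fun i => (f i : ℂ)) * star U)ᴴ =
      U * diagonal (fun i => (f i : ℂ)) * star U := fun f => by
    rw [conjTranspose_mul, conjTranspose_mul, diagonal_conjTranspose, star_eq_conjTranspose,
      conjTranspose_conjTranspose, mul_assoc]
    congr 3
    ext i
    simp
  have hmul : ∀ f g : n → ℝ, (U * diagonal (fun i => (f i : ℂ)) * star U) *
      (U * diagonal (fun i => (g i : ℂ)) * star U) =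
      U * diagonal (fun i => ((f i * g i : ℝ) : ℂ)) * star U := fun f g => by
    calc _ = U * diagonal (fun i => (f i : ℂ)) * (star U * U) *
          diagonal (fun i => (g i : ℂ)) * star U := by simp only [mul_assoc]
      _ = _ := by
        rw [hUU, mul_one, mul_assoc U, diagonal_mul_diagonal]
        simp only [Complex.ofReal_mul]
  have hR : psdRpow K (-1 / 2) =
      U * diagonal (fun i => ((hH.eigenvalues i ^ (-1 / 2 : ℝ) : ℝ) : ℂ)) * star U :=
    cfc_eq_unitary_conj hH _
  refine ⟨U * diagonal (fun i => ((hH.eigenvalues i ^ (1 / 2 : ℝ) : ℝ) : ℂ)) * star U,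
    hadj _, ?_, ?_, ?_⟩
  · rw [hmul]
    conv_rhs => rw [eq_unitary_conj hH, ← hU]
    congr 3
    ext i
    rw [← Real.rpow_add (hK.eigenvalues_pos i)]
    norm_num
  · rw [hR, hadj]
  · rw [hR, hmul]
    have : (fun i => ((hH.eigenvalues i ^ (-1 / 2 : ℝ) * hH.eigenvalues i ^ (1 / 2 : ℝ) : ℝ) : ℂ)) =
        fun _ => 1 := by
      ext i
      rw [← Real.rpow_add (hK.eigenvalues_pos i)]
      norm_num
    rw [this, diagonal_one, mul_one, hUU']

/-- The matrix `(B + t 1)^(-1/2) A (B + t 1)^(-1/2)`. -/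
noncomputable def symmQuotient (A B : Matrix n n ℂ) (t : ℝ) : Matrix n n ℂ :=
  psdRpow (B + (t : ℂ) • (1 : Matrix n n ℂ)) (-1 / 2) * A *
    psdRpow (B + (t : ℂ) • (1 : Matrix n n ℂ)) (-1 / 2)

variable {A B : Matrix n n ℂ}

theorem symmQuotient_posSemidef (hA : A.PosSemidef) (hB : B.PosSemidef) {t : ℝ} (ht : 0 < t) :
    (symmQuotient A B t).PosSemidef := by
  obtain ⟨S, -, -, hR, -⟩ := exists_sqrt_inverse_psdRpow (posDef_add_smul_one hB ht)
  have := hA.mul_mul_conjTranspose_same (psdRpow (B + (t : ℂ) • (1 : Matrix n n ℂ)) (-1 / 2))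
  rwa [hR] at this

theorem trace_symmQuotientPow (α : ℝ) {t : ℝ} (hM : (symmQuotient A B t).IsHermitian) :
    (symmQuotientPow α A B t).trace = ((∑ i, hM.eigenvalues i ^ α : ℝ) : ℂ) :=
  trace_cfc hM _

/-- Writing `R` for `(B + t)^(-1/2)` and `S = R⁻¹`, the matrix `A (B + t)⁻¹` equals
`S (R A R) R`, hence is similar to the symmetrized quotient. -/
theorem trace_quotientPow (hA : A.PosSemidef) (hB : B.PosSemidef) (α : ℝ) {t : ℝ} (ht : 0 < t) :
    (quotientPow α A B t).trace = (symmQuotientPow α A B t).trace := by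
  have hM := symmQuotient_posSemidef hA hB ht
  obtain ⟨S, -, hSS, -, hRS⟩ := exists_sqrt_inverse_psdRpow (posDef_add_smul_one hB ht)
  rw [trace_symmQuotientPow α hM.isHermitian]
  set K := B + (t : ℂ) • (1 : Matrix n n ℂ)
  have hSR := mul_eq_one_comm.mp hRS
  set R := psdRpow K (-1 / 2) with hR
  set V := (hM.isHermitian.eigenvectorUnitary : Matrix n n ℂ) with hV
  have hVV : star V * V = 1 := Unitary.coe_star_mul_self _
  have hKinv : K⁻¹ = R * R := by
    refine inv_eq_right_inv ?_
    rw [← hSS, mul_assoc, ← mul_assoc S R, hSR, one_mul, hSR]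
  have hX : A * K⁻¹ = S * V * diagonal (fun i => (hM.isHermitian.eigenvalues i : ℂ)) *
      (star V * R) := by
    calc A * K⁻¹ = S * symmQuotient A B t * R := by
          change _ = S * (R * A * R) * R
          rw [hKinv, ← mul_assoc S, ← mul_assoc S, hSR, one_mul, mul_assoc]
      _ = _ := by
          conv_lhs => rw [eq_unitary_conj hM.isHermitian, ← hV]
          simp only [mul_assoc]
  have hTS : star V * R * (S * V) = 1 := by
    rw [mul_assoc, ← mul_assoc R, hRS, one_mul, hVV]
  change (diagonalizableFun _ (A * K⁻¹)).trace = _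
  rw [hX, trace_diagonalizableFun _ _ _ hTS, Complex.ofReal_sum]
  exact sum_congr rfl fun i _ => (Complex.ofReal_cpow (hM.eigenvalues_nonneg i) α).symm

omit [Fintype n] [DecidableEq n] in
theorem isHermitian_sub_smul (hA : A.IsHermitian) (hB : B.IsHermitian) (γ : ℝ) :
    (A - (γ : ℂ) • B).IsHermitian :=
  hA.sub (hB.smul (by simp [IsSelfAdjoint]))

/-- `A - γ B - γ t` and `M - γ`, where `M` is the symmetrized quotient at `t`, are congruent via
`(B + t)^(1/2)`, so they have the same number of positive eigenvalues. -/
theorem card_eigenvalues_symmQuotient (hB : B.PosSemidef) (γ : ℝ) {t : ℝ}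
    (ht : 0 < t) (hM : (symmQuotient A B t).IsHermitian) (hG : (A - (γ : ℂ) • B).IsHermitian) :
    #{i | γ < hM.eigenvalues i} = #{i | γ * t < hG.eigenvalues i} := by
  obtain ⟨S, hS, hSS, hR, hRS⟩ := exists_sqrt_inverse_psdRpow (posDef_add_smul_one hB ht)
  have hSR := mul_eq_one_comm.mp hRS
  set R := psdRpow (B + (t : ℂ) • (1 : Matrix n n ℂ)) (-1 / 2) with hRdef
  set G := A - (γ : ℂ) • B - ((γ * t : ℝ) : ℂ) • (1 : Matrix n n ℂ)
  have hRG : R * G * R = symmQuotient A B t - (γ : ℂ) • (1 : Matrix n n ℂ) := by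
    have hGS : G = A - (γ : ℂ) • (S * S) := by
      rw [hSS, smul_add, smul_smul, ← Complex.ofReal_mul, ← sub_sub]
    have h1 : R * (S * S) * R = 1 := by
      rw [← mul_assoc, hRS, one_mul, hSR]
    rw [hGS, mul_sub, sub_mul, mul_smul_comm, smul_mul_assoc, h1]
    rfl
  have hSG : S * (symmQuotient A B t - (γ : ℂ) • (1 : Matrix n n ℂ)) * S = G := by
    rw [← hRG, ← mul_assoc, ← mul_assoc, hSR, one_mul, mul_assoc, hRS, mul_one]
  apply le_antisymm
  · refine card_eigenvalues_le hM hG R γ (γ * t) ?_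
    rw [hR, hRG, sub_self]
    exact PosSemidef.zero
  · refine card_eigenvalues_le hG hM S (γ * t) γ ?_
    rw [hS, hSG, sub_self]
    exact PosSemidef.zero

theorem antitone_eigenvalues₀_sub_smul (hB : B.PosSemidef)
    (hG : ∀ γ : ℝ, (A - (γ : ℂ) • B).IsHermitian) (k : Fin (Fintype.card n)) :
    Antitone fun γ => (hG γ).eigenvalues₀ k := by
  intro γ γ' hle
  refine eigenvalues₀_le _ _ ?_ k
  have : A - (γ : ℂ) • B - (A - (γ' : ℂ) • B) = ((γ' - γ : ℝ) : ℂ) • B := by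
    rw [sub_sub_sub_cancel_left, ← sub_smul, Complex.ofReal_sub]
  rw [this]
  exact hB.smul (by exact_mod_cast sub_nonneg.mpr hle)

theorem exists_posSemidef_smul_one_sub (hA : A.PosSemidef) :
    ∃ τ : ℝ, 0 ≤ τ ∧ ((τ : ℂ) • (1 : Matrix n n ℂ) - A).PosSemidef := by
  have hH := hA.isHermitian
  set τ := ∑ i, hH.eigenvalues i
  refine ⟨τ, sum_nonneg fun i _ => hA.eigenvalues_nonneg i, ?_⟩
  have hd : (diagonal fun i => ((τ - hH.eigenvalues i : ℝ) : ℂ)).PosSemidef :=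
    PosSemidef.diagonal fun i => by
      have : hH.eigenvalues i ≤ τ :=
        single_le_sum (f := hH.eigenvalues) (fun j _ => hA.eigenvalues_nonneg j) (mem_univ i)
      simpa using this
  have := hd.mul_mul_conjTranspose_same (hH.eigenvectorUnitary : Matrix n n ℂ)
  convert this using 1
  have h1 : (diagonal fun i => ((τ - hH.eigenvalues i : ℝ) : ℂ)) =
      (τ : ℂ) • (1 : Matrix n n ℂ) - diagonal fun i => (hH.eigenvalues i : ℂ) := by
    rw [smul_one_eq_diagonal, diagonal_sub]
    simp
  rw [h1, mul_sub, sub_mul, ← star_eq_conjTranspose, ← eq_unitary_conj hH]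
  simp

/-- `A ≪ B` implies `A ≤ c B`: with `Q` the projection onto the support of `B` and `A ≤ τ`, one has
`A = Q A Q ≤ τ Q ≤ c B`. -/
theorem exists_posSemidef_smul_sub (hA : A.PosSemidef) (hB : B.PosSemidef) (h : SuppLE A B) :
    ∃ c : ℝ, ((c : ℂ) • B - A).PosSemidef := by
  obtain ⟨τ, hτ, hτA⟩ := exists_posSemidef_smul_one_sub hA
  have hH := hB.isHermitian
  set U := (hH.eigenvectorUnitary : Matrix n n ℂ) with hU
  set b := hH.eigenvalues
  have hb : ∀ i, 0 ≤ b i := hB.eigenvalues_nonneg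
  have hUU : star U * U = 1 := Unitary.coe_star_mul_self _
  -- `p` is the diagonal of the projection onto the support of `B` in an eigenbasis of `B`.
  let p : n → ℂ := fun i => if b i = 0 then 0 else 1
  set Q := U * diagonal p * star U with hQ
  have hQadj : Qᴴ = Q := by
    rw [hQ, conjTranspose_mul, conjTranspose_mul, diagonal_conjTranspose, star_eq_conjTranspose,
      conjTranspose_conjTranspose, mul_assoc]
    congr 3
    ext i
    simp only [p, Pi.star_apply]
    split_ifs <;> simp
  have hQQ : Q * Q = Q := by
    calc Q * Q = U * diagonal p * (star U * U) * diagonal p * star U := by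
          simp only [hQ, mul_assoc]
      _ = Q := by
        rw [hUU, mul_one, mul_assoc U, diagonal_mul_diagonal, hQ]
        congr 3
        ext i
        simp only [p]
        split_ifs <;> simp
  have hBQ : B * (1 - Q) = 0 := by
    have : B * Q = B := by
      conv_lhs => rw [eq_unitary_conj hH, ← hU]
      calc _ = U * diagonal (fun i => (b i : ℂ)) * (star U * U) * diagonal p * star U := by
            simp only [hQ, mul_assoc]; rfl
        _ = B := by
          rw [hUU, mul_one, mul_assoc U, diagonal_mul_diagonal]
          conv_rhs => rw [eq_unitary_conj hH, ← hU]
          congr 3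
          ext i
          by_cases hi : b i = 0
          · have hi' : hH.eigenvalues i = 0 := hi
            simp [p, hi, hi']
          · simp [p, hi, b]
    rw [mul_sub, mul_one, this, sub_self]
  have hAQ : A * Q = A := by
    have : A * (1 - Q) = 0 := by
      refine Matrix.ext_of_mulVec_single fun i => ?_
      have h1 : (1 - Q) *ᵥ Pi.single i 1 ∈ LinearMap.ker B.mulVecLin := by
        rw [LinearMap.mem_ker, mulVecLin_apply, mulVec_mulVec, hBQ, zero_mulVec]
      have h2 := h h1
      rw [LinearMap.mem_ker, mulVecLin_apply, mulVec_mulVec] at h2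
      rw [h2, zero_mulVec]
    rw [mul_sub, mul_one, sub_eq_zero] at this
    exact this.symm
  have hQA : Q * A = A := by
    have := congrArg conjTranspose hAQ
    rwa [conjTranspose_mul, hQadj, hA.isHermitian] at this
  -- Terms with `b i = 0` vanish since `τ / 0 = 0`; each other term `τ / b i` is at most `c`.
  set c := ∑ i, τ / b i
  refine ⟨c, ?_⟩
  have h1 : ((τ : ℂ) • Q - A).PosSemidef := by
    have := hτA.mul_mul_conjTranspose_same Q
    rwa [hQadj, mul_sub, sub_mul, hQA, hAQ, mul_smul_comm, smul_mul_assoc, mul_one, hQQ] at this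
  have h2 : ((c : ℂ) • B - (τ : ℂ) • Q).PosSemidef := by
    have hd : (diagonal fun i => (c : ℂ) * b i - τ * p i).PosSemidef := by
      refine PosSemidef.diagonal fun i => ?_
      by_cases hi : b i = 0
      · simp [p, hi]
      · have hpos : 0 < b i := (hb i).lt_of_ne' hi
        have hc : τ / b i ≤ c :=
          single_le_sum (f := fun j => τ / b j) (fun j _ => div_nonneg hτ (hb j)) (mem_univ i)
        rw [div_le_iff₀ hpos] at hc
        simp only [p, hi, Pi.zero_apply, if_false, mul_one, sub_nonneg]
        exact_mod_cast hc
    have := hd.mul_mul_conjTranspose_same U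
    convert this using 1
    have h3 : (diagonal fun i => (c : ℂ) * b i - τ * p i) =
        (c : ℂ) • diagonal (fun i => (b i : ℂ)) - (τ : ℂ) • diagonal p := by
      rw [← diagonal_smul, ← diagonal_smul, diagonal_sub]
      rfl
    rw [h3, mul_sub, sub_mul, mul_smul_comm, smul_mul_assoc, mul_smul_comm, smul_mul_assoc,
      ← star_eq_conjTranspose, hQ]
    conv_lhs => rw [eq_unitary_conj hH]
  simpa using h2.add h1

end Pencil

/-! ### The hockey-stick divergence -/

section HockeyStick

variable {n : Type*} [Fintype n] [DecidableEq n] {A B : Matrix n n ℂ}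

theorem hockeyStick_eq_sum {γ : ℝ} (hG : (A - (γ : ℂ) • B).IsHermitian) :
    hockeyStick γ A B = ∑ k, max (hG.eigenvalues₀ k) 0 := by
  rw [hockeyStick, trace_posPart hG, sum_eigenvalues_eq hG fun x => max x 0]

theorem hockeyStick_nonneg (hA : A.PosSemidef) (hB : B.PosSemidef) (γ : ℝ) :
    0 ≤ hockeyStick γ A B := by
  rw [hockeyStick_eq_sum (isHermitian_sub_smul hA.isHermitian hB.isHermitian γ)]
  exact sum_nonneg fun _ _ => le_max_right _ _

theorem antitone_hockeyStick (hA : A.PosSemidef) (hB : B.PosSemidef) :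
    Antitone fun γ => hockeyStick γ A B := by
  intro γ γ' h
  have hG := isHermitian_sub_smul hA.isHermitian hB.isHermitian
  simp only [hockeyStick_eq_sum (hG _)]
  exact sum_le_sum fun k _ => max_le_max_right 0 (antitone_eigenvalues₀_sub_smul hB hG k h)

theorem hockeyStick_le_trace (hA : A.PosSemidef) (hB : B.PosSemidef) {γ : ℝ} (hγ : 0 ≤ γ) :
    hockeyStick γ A B ≤ A.trace.re := by
  refine (antitone_hockeyStick hA hB hγ).trans_eq ?_
  have h0 : A - ((0 : ℝ) : ℂ) • B = A := by simp
  simp only [hockeyStick, h0]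
  rw [trace_posPart hA.isHermitian]
  conv_rhs => rw [hA.isHermitian.trace_eq_sum_eigenvalues]
  simp [max_eq_left (hA.eigenvalues_nonneg _)]

/-- `E_{1/s}(A‖B)` in terms of `E_s(B‖A)`, from `X₊ - X₋ = X` for `X = A - s⁻¹ B`, whose negative
part is `s⁻¹ (B - s A)₊`. -/
theorem hockeyStick_inv (hA : A.PosSemidef) (hB : B.PosSemidef) {s : ℝ} (hs : 0 < s) :
    hockeyStick s⁻¹ A B = A.trace.re - s⁻¹ * B.trace.re + s⁻¹ * hockeyStick s B A := by
  set a := A - ((s⁻¹ : ℝ) : ℂ) • B with ha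
  have hsa : IsSelfAdjoint a := isHermitian_sub_smul hA.isHermitian hB.isHermitian _
  have h1 : a⁺ - a⁻ = a := CFC.posPart_sub_negPart a hsa
  have h2 : a⁻ = (s⁻¹ : ℝ) • (B - (s : ℂ) • A)⁺ := by
    rw [← CFC.posPart_neg, ← CFC.posPart_smul_of_nonneg (inv_nonneg.mpr hs.le)]
    congr 1
    have hs' : (s : ℂ) ≠ 0 := by exact_mod_cast hs.ne'
    rw [ha, ← Complex.coe_smul, smul_sub, smul_smul, Complex.ofReal_inv, inv_mul_cancel₀ hs',
      one_smul, neg_sub]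
  have h3 := congrArg (fun M : Matrix n n ℂ => M.trace.re) h1
  rw [h2] at h3
  simp only [trace_sub, trace_smul, Complex.sub_re, Complex.smul_re, smul_eq_mul] at h3
  have h4 : a.trace.re = A.trace.re - s⁻¹ * B.trace.re := by
    simp only [ha, trace_sub, trace_smul, Complex.sub_re, smul_eq_mul, Complex.re_ofReal_mul]
  change a⁺.trace.re = _ + s⁻¹ * (B - (s : ℂ) • A)⁺.trace.re
  linarith

theorem hockeyStick_eq_zero (hA : A.PosSemidef) (hB : B.PosSemidef) {c γ : ℝ}
    (h : ((c : ℂ) • B - A).PosSemidef) (hγ : c ≤ γ) : hockeyStick γ A B = 0 := by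
  refine le_antisymm ((antitone_hockeyStick hA hB hγ).trans ?_) (hockeyStick_nonneg hA hB γ)
  have hG := isHermitian_sub_smul hA.isHermitian hB.isHermitian c
  simp only [hockeyStick]
  rw [trace_posPart hG]
  refine sum_nonpos fun i _ => max_le ?_ le_rfl
  have h' : (-(A - (c : ℂ) • B)).PosSemidef := by rwa [neg_sub]
  have hi := h'.dotProduct_mulVec_nonneg (hG.eigenvectorBasis i)
  rw [neg_mulVec, dotProduct_neg] at hi
  rw [hG.eigenvalues_eq]
  exact neg_nonneg.mp (Complex.le_def.mp hi).1

end HockeyStick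

/-! ### One-dimensional integrals -/

section LayerCake

theorem lintegral_ite_mul_lt {γ : ℝ} (hγ : 0 < γ) (x : ℝ) :
    ∫⁻ t in Set.Ioi (0 : ℝ), (if γ * t < x then 1 else 0 : ℝ≥0∞) =
      ENNReal.ofReal (γ⁻¹ * max x 0) := by
  have h : (fun t : ℝ => (if γ * t < x then 1 else 0 : ℝ≥0∞)) = (Set.Iio (x / γ)).indicator 1 := by
    ext t
    simp [Set.indicator_apply, lt_div_iff₀ hγ, mul_comm]
  rw [h, lintegral_indicator_one measurableSet_Iio, Measure.restrict_apply measurableSet_Iio,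
    Set.inter_comm, Set.Ioi_inter_Iio, Real.volume_Ioo, sub_zero,
    mul_max_of_nonneg _ _ (inv_nonneg.mpr hγ.le), mul_zero, ENNReal.ofReal_max]
  simp [div_eq_inv_mul]

theorem lintegral_ite_lt_rpow {α : ℝ} (hα : 0 < α) {x : ℝ} (hx : 0 ≤ x) :
    ∫⁻ γ in Set.Ioi (0 : ℝ), (if γ < x then 1 else 0 : ℝ≥0∞) * ENNReal.ofReal (α * γ ^ (α - 1)) =
      ENNReal.ofReal (x ^ α) := by
  have h : (fun γ : ℝ => (if γ < x then 1 else 0 : ℝ≥0∞) * ENNReal.ofReal (α * γ ^ (α - 1))) =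
      (Set.Iio x).indicator fun γ => ENNReal.ofReal (α * γ ^ (α - 1)) := by
    ext γ
    simp [Set.indicator_apply]
  have hint : IntervalIntegrable (fun γ : ℝ => α * γ ^ (α - 1)) volume 0 x :=
    (intervalIntegral.intervalIntegrable_rpow' (by linarith)).const_mul α
  rw [h, lintegral_indicator measurableSet_Iio, Measure.restrict_restrict measurableSet_Iio,
    Set.inter_comm, Set.Ioi_inter_Iio, restrict_Ioo_eq_restrict_Ioc,
    ← ofReal_integral_eq_lintegral_ofReal]
  · rw [← intervalIntegral.integral_of_le hx, intervalIntegral.integral_const_mul,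
      integral_rpow (Or.inl (by linarith)), sub_add_cancel, Real.zero_rpow hα.ne', sub_zero,
      mul_div_cancel₀ _ hα.ne']
  · exact (intervalIntegrable_iff_integrableOn_Ioc_of_le hx).mp hint
  · filter_upwards [ae_restrict_mem measurableSet_Ioc] with γ hγ
    have := hγ.1
    positivity

theorem lintegral_Ioi_mul_rpow {p : ℝ} (hp : 0 < p) {a : ℝ} (ha : 0 ≤ a) :
    ∫⁻ s in Set.Ioi (1 : ℝ), ENNReal.ofReal (s ^ (-p - 1) * a) = ENNReal.ofReal (a / p) := by
  rw [← ofReal_integral_eq_lintegral_ofReal]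
  · rw [integral_mul_const, integral_Ioi_rpow_of_lt (by linarith) one_pos, Real.one_rpow]
    congr 1
    rw [show -p - 1 + 1 = -p by ring]
    field_simp
  · exact (integrableOn_Ioi_rpow_of_lt (by linarith) one_pos).mul_const a
  · filter_upwards [ae_restrict_mem measurableSet_Ioi] with s hs
    have : (0 : ℝ) < s := one_pos.trans hs
    positivity

end LayerCake

/-! ### The Hellinger divergence as a trace integral -/

section TraceIntegral

variable {n : Type*} [Fintype n] [DecidableEq n] {A B : Matrix n n ℂ}

/-- Both sides are the double integral of `α γ^(α-1)` times the number of eigenvalues of the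
symmetrized quotient at `t` that exceed `γ`. -/
theorem lintegral_trace_symmQuotientPow (hA : A.PosSemidef) (hB : B.PosSemidef) {α : ℝ}
    (hα : 1 < α) :
    ∫⁻ t in Set.Ioi (0 : ℝ), ENNReal.ofReal (symmQuotientPow α A B t).trace.re =
      ENNReal.ofReal α * ∫⁻ γ in Set.Ioi (0 : ℝ),
        ENNReal.ofReal (γ ^ (α - 2) * hockeyStick γ A B) := by
  have hα0 : 0 < α := one_pos.trans hα
  have hG := isHermitian_sub_smul hA.isHermitian hB.isHermitian
  let lam : Fin (Fintype.card n) → ℝ → ℝ := fun k γ => (hG γ).eigenvalues₀ k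
  have hlam : ∀ k, Measurable (lam k) := fun k =>
    (antitone_eigenvalues₀_sub_smul hB hG k).measurable
  -- `N t γ` counts the eigenvalues of `A - γ B` above `γ t`; in terms of the sorted eigenvalues,
  -- which are antitone in `γ`, it is jointly measurable.
  let N : ℝ → ℝ → ℝ≥0∞ := fun t γ => ∑ k, if γ * t < lam k γ then 1 else 0
  have hN : Measurable (Function.uncurry N) := by
    refine Finset.measurable_sum _ fun k _ => Measurable.ite ?_ measurable_const measurable_const
    exact measurableSet_lt (measurable_snd.mul measurable_fst) ((hlam k).comp measurable_snd)
  have hw : Measurable fun γ : ℝ => ENNReal.ofReal (α * γ ^ (α - 1)) := by fun_prop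
  calc ∫⁻ t in Set.Ioi (0 : ℝ), ENNReal.ofReal (symmQuotientPow α A B t).trace.re
      = ∫⁻ t in Set.Ioi (0 : ℝ), ∫⁻ γ in Set.Ioi (0 : ℝ),
          N t γ * ENNReal.ofReal (α * γ ^ (α - 1)) := by
        refine setLIntegral_congr_fun measurableSet_Ioi fun t ht => ?_
        have hM := symmQuotient_posSemidef hA hB ht
        have hcount : ∀ γ, N t γ = ∑ i, if γ < hM.isHermitian.eigenvalues i then 1 else 0 :=
          fun γ => by
            have := card_eigenvalues_symmQuotient hB γ ht hM.isHermitian (hG γ)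
            rw [Finset.sum_boole, this, ← Finset.sum_boole]
            exact (sum_eigenvalues_eq (hG γ) fun x => if γ * t < x then (1 : ℝ≥0∞) else 0).symm
        simp only [hcount, Finset.sum_mul]
        have hmeas : ∀ i, Measurable fun γ : ℝ =>
            (if γ < hM.isHermitian.eigenvalues i then 1 else 0 : ℝ≥0∞) *
              ENNReal.ofReal (α * γ ^ (α - 1)) := fun i =>
          (Measurable.ite measurableSet_Iio measurable_const measurable_const).mul hw
        rw [lintegral_finsetSum _ fun i _ => hmeas i]
        rw [trace_symmQuotientPow α hM.isHermitian, Complex.ofReal_re,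
          ENNReal.ofReal_sum_of_nonneg fun i _ => Real.rpow_nonneg (hM.eigenvalues_nonneg i) α]
        exact Finset.sum_congr rfl fun i _ =>
          (lintegral_ite_lt_rpow hα0 (hM.eigenvalues_nonneg i)).symm
    _ = ∫⁻ γ in Set.Ioi (0 : ℝ), ∫⁻ t in Set.Ioi (0 : ℝ),
          N t γ * ENNReal.ofReal (α * γ ^ (α - 1)) :=
        lintegral_lintegral_swap (hN.mul (hw.comp measurable_snd)).aemeasurable
    _ = ∫⁻ γ in Set.Ioi (0 : ℝ),
          ENNReal.ofReal α * ENNReal.ofReal (γ ^ (α - 2) * hockeyStick γ A B) := by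
        refine setLIntegral_congr_fun measurableSet_Ioi fun γ hγ => ?_
        have hγ' : 0 < γ := hγ
        have hmeas : ∀ k, Measurable fun t : ℝ => (if γ * t < lam k γ then 1 else 0 : ℝ≥0∞) :=
          fun k => Measurable.ite (measurableSet_lt (by fun_prop) measurable_const)
            measurable_const measurable_const
        change ∫⁻ t in Set.Ioi (0 : ℝ), (∑ k, if γ * t < lam k γ then 1 else 0) * _ = _
        rw [lintegral_mul_const _ (Finset.measurable_sum _ fun k _ => hmeas k),
          lintegral_finsetSum _ fun k _ => hmeas k]
        simp only [lintegral_ite_mul_lt hγ']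
        rw [← ENNReal.ofReal_sum_of_nonneg fun k _ => by positivity, ← Finset.mul_sum,
          ← hockeyStick_eq_sum (hG γ), ← ENNReal.ofReal_mul hα0.le, ← ENNReal.ofReal_mul
          (mul_nonneg (inv_nonneg.mpr hγ'.le) (hockeyStick_nonneg hA hB γ))]
        congr 1
        have : γ ^ (α - 1) = γ ^ (α - 2) * γ := by
          rw [← Real.rpow_add_one hγ'.ne']
          congr 1
          ring
        rw [this]
        field_simp
    _ = _ := by
        rw [lintegral_const_mul' _ _ ENNReal.ofReal_ne_top]

theorem lintegral_Ioo_hockeyStick_eq (A B : Matrix n n ℂ) (α : ℝ) :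
    ∫⁻ γ in Set.Ioo (0 : ℝ) 1, ENNReal.ofReal (γ ^ (α - 2) * hockeyStick γ A B) =
      ∫⁻ s in Set.Ioi (1 : ℝ), ENNReal.ofReal (s ^ (-α) * hockeyStick s⁻¹ A B) := by
  have himg : (fun s : ℝ => s⁻¹) '' Set.Ioi 1 = Set.Ioo 0 1 := by
    rw [Set.image_inv_eq_inv]
    ext s
    simp only [Set.mem_inv, Set.mem_Ioi, Set.mem_Ioo]
    exact one_lt_inv_iff₀
  rw [← himg, lintegral_image_eq_lintegral_abs_deriv_mul measurableSet_Ioi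
    (f' := fun s => -(s ^ 2)⁻¹) (fun s hs => (hasDerivAt_inv
      (one_pos.trans hs : (0 : ℝ) < s).ne').hasDerivWithinAt) inv_injective.injOn]
  refine setLIntegral_congr_fun measurableSet_Ioi fun s hs => ?_
  have hs0 : (0 : ℝ) < s := one_pos.trans hs
  rw [← ENNReal.ofReal_mul (abs_nonneg _), abs_neg, abs_of_pos (by positivity), ← mul_assoc]
  congr 2
  rw [Real.inv_rpow hs0.le, ← Real.rpow_neg hs0.le, ← Real.rpow_natCast, ← Real.rpow_neg hs0.le,
    ← Real.rpow_add hs0]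
  congr 1
  push_cast
  ring

/-- The part of the integral over `0 < γ < 1`, evaluated by `γ = 1/s` and `hockeyStick_inv`. The
term `Tr B` stands on the left because the identity is one in `[0, ∞]`. -/
theorem lintegral_Ioo_hockeyStick_add (hA : A.PosSemidef) (hB : B.PosSemidef) {α : ℝ}
    (hα : 1 < α) :
    ENNReal.ofReal α * (∫⁻ γ in Set.Ioo (0 : ℝ) 1,
        ENNReal.ofReal (γ ^ (α - 2) * hockeyStick γ A B)) + ENNReal.ofReal B.trace.re =
      ENNReal.ofReal (α / (α - 1) * A.trace.re) + ENNReal.ofReal α *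
        ∫⁻ γ in Set.Ioi (1 : ℝ), ENNReal.ofReal (γ ^ (-α - 1) * hockeyStick γ B A) := by
  have hα0 : 0 < α := one_pos.trans hα
  have ha : 0 ≤ A.trace.re := (Complex.le_def.mp hA.trace_nonneg).1
  have hb : 0 ≤ B.trace.re := (Complex.le_def.mp hB.trace_nonneg).1
  have hbα : ENNReal.ofReal B.trace.re = ENNReal.ofReal α *
      ∫⁻ s in Set.Ioi (1 : ℝ), ENNReal.ofReal (s ^ (-α - 1) * B.trace.re) := by
    rw [lintegral_Ioi_mul_rpow hα0 hb, ← ENNReal.ofReal_mul hα0.le, mul_div_cancel₀ _ hα0.ne']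
  have haα : ENNReal.ofReal (α / (α - 1) * A.trace.re) = ENNReal.ofReal α *
      ∫⁻ s in Set.Ioi (1 : ℝ), ENNReal.ofReal (s ^ (-(α - 1) - 1) * A.trace.re) := by
    rw [lintegral_Ioi_mul_rpow (sub_pos.mpr hα) ha, ← ENNReal.ofReal_mul hα0.le]
    congr 1
    ring
  rw [haα, hbα, lintegral_Ioo_hockeyStick_eq, ← mul_add, ← mul_add,
    ← lintegral_add_right _ (by fun_prop), ← lintegral_add_left (by fun_prop)]
  congr 1
  refine setLIntegral_congr_fun measurableSet_Ioi fun s hs => ?_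
  have hs0 : (0 : ℝ) < s := one_pos.trans hs
  rw [← ENNReal.ofReal_add (mul_nonneg (by positivity) (hockeyStick_nonneg hA hB _)) (by positivity),
    ← ENNReal.ofReal_add (by positivity) (mul_nonneg (by positivity) (hockeyStick_nonneg hB hA _))]
  congr 1
  have h1 : s ^ (-α - 1) = s ^ (-α) * s⁻¹ := by
    rw [Real.rpow_sub_one hs0.ne', div_eq_mul_inv]
  rw [hockeyStick_inv hA hB hs0, h1, show -(α - 1) - 1 = -α by ring]
  ring

theorem lintegral_Ioi_one_hockeyStick_le (hA : A.PosSemidef) (hB : B.PosSemidef) {α : ℝ}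
    (hα : 1 < α) :
    ENNReal.ofReal α *
      (∫⁻ γ in Set.Ioi (1 : ℝ), ENNReal.ofReal (γ ^ (-α - 1) * hockeyStick γ B A)) ≤
        ENNReal.ofReal B.trace.re := by
  have hα0 : 0 < α := one_pos.trans hα
  have hb : 0 ≤ B.trace.re := (Complex.le_def.mp hB.trace_nonneg).1
  calc _ ≤ ENNReal.ofReal α *
        ∫⁻ s in Set.Ioi (1 : ℝ), ENNReal.ofReal (s ^ (-α - 1) * B.trace.re) := by
        refine mul_le_mul_right (setLIntegral_mono' measurableSet_Ioi fun s hs =>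
          ENNReal.ofReal_le_ofReal ?_) _
        have hs0 : (0 : ℝ) < s := one_pos.trans hs
        exact mul_le_mul_of_nonneg_left (hockeyStick_le_trace hB hA hs0.le) (by positivity)
    _ = _ := by
      rw [lintegral_Ioi_mul_rpow hα0 hb, ← ENNReal.ofReal_mul hα0.le, mul_div_cancel₀ _ hα0.ne']

theorem lintegral_Ioi_zero_hockeyStick_eq_add (A B : Matrix n n ℂ) (α : ℝ) :
    ∫⁻ γ in Set.Ioi (0 : ℝ), ENNReal.ofReal (γ ^ (α - 2) * hockeyStick γ A B) =
      (∫⁻ γ in Set.Ioo (0 : ℝ) 1, ENNReal.ofReal (γ ^ (α - 2) * hockeyStick γ A B)) +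
        ∫⁻ γ in Set.Ioi (1 : ℝ), ENNReal.ofReal (γ ^ (α - 2) * hockeyStick γ A B) := by
  rw [restrict_Ioo_eq_restrict_Ioc, ← lintegral_union measurableSet_Ioi (Set.Ioc_disjoint_Ioi_same),
    Set.Ioc_union_Ioi_eq_Ioi zero_le_one]

theorem hellinger_eq_trace_integral (hA : A.PosSemidef) (hB : B.PosSemidef) {α : ℝ} (hα : 1 < α) :
    hellinger α A B = ((-1 / (α - 1) * A.trace.re : ℝ) : EReal) +
      ((∫⁻ t in Set.Ioi (0 : ℝ), ENNReal.ofReal (symmQuotientPow α A B t).trace.re : ℝ≥0∞) :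
        EReal) := by
  have hα1 : 0 < α - 1 := sub_pos.mpr hα
  have ha : 0 ≤ A.trace.re := (Complex.le_def.mp hA.trace_nonneg).1
  have hb : 0 ≤ B.trace.re := (Complex.le_def.mp hB.trace_nonneg).1
  have hsplit : ∫⁻ γ in Set.Ioi (1 : ℝ), ENNReal.ofReal
        (γ ^ (α - 2) * hockeyStick γ A B + γ ^ (-α - 1) * hockeyStick γ B A) =
      (∫⁻ γ in Set.Ioi (1 : ℝ), ENNReal.ofReal (γ ^ (α - 2) * hockeyStick γ A B)) +
        ∫⁻ γ in Set.Ioi (1 : ℝ), ENNReal.ofReal (γ ^ (-α - 1) * hockeyStick γ B A) := by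
    have hm := (antitone_hockeyStick hA hB).measurable
    rw [← lintegral_add_left (by fun_prop)]
    refine setLIntegral_congr_fun measurableSet_Ioi fun s hs => ?_
    have hs0 : (0 : ℝ) < s := one_pos.trans hs
    exact ENNReal.ofReal_add (mul_nonneg (by positivity) (hockeyStick_nonneg hA hB _))
      (mul_nonneg (by positivity) (hockeyStick_nonneg hB hA _))
  have hadd := lintegral_Ioo_hockeyStick_add hA hB hα
  have hle := lintegral_Ioi_one_hockeyStick_le hA hB hα
  rw [hellinger, hsplit, lintegral_trace_symmQuotientPow hA hB hα,
    lintegral_Ioi_zero_hockeyStick_eq_add, mul_add, mul_add]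
  generalize ENNReal.ofReal α * (∫⁻ γ in Set.Ioo (0 : ℝ) 1,
    ENNReal.ofReal (γ ^ (α - 2) * hockeyStick γ A B)) = X at *
  generalize ENNReal.ofReal α * (∫⁻ γ in Set.Ioi (1 : ℝ),
    ENNReal.ofReal (γ ^ (-α - 1) * hockeyStick γ B A)) = Y at *
  generalize ENNReal.ofReal α * (∫⁻ γ in Set.Ioi (1 : ℝ),
    ENNReal.ofReal (γ ^ (α - 2) * hockeyStick γ A B)) = P at *
  have hY : Y ≠ ⊤ := ne_top_of_le_ne_top ENNReal.ofReal_ne_top hle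
  have hX : X ≠ ⊤ := fun h => by
    rw [h, top_add] at hadd
    exact ENNReal.add_ne_top.mpr ⟨ENNReal.ofReal_ne_top, hY⟩ hadd.symm
  -- `X` and `Y` are finite, so the identity can be rearranged in `ℝ`; only `P` may be infinite.
  have hreal : X.toReal + B.trace.re = α / (α - 1) * A.trace.re + Y.toReal := by
    have := congrArg ENNReal.toReal hadd
    rwa [ENNReal.toReal_add hX ENNReal.ofReal_ne_top, ENNReal.toReal_add ENNReal.ofReal_ne_top hY,
      ENNReal.toReal_ofReal hb, ENNReal.toReal_ofReal (by positivity)] at this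
  have hXY : (A - B).trace.re + Y.toReal = -1 / (α - 1) * A.trace.re + X.toReal := by
    have : α / (α - 1) = 1 + 1 / (α - 1) := by field_simp; ring
    rw [trace_sub, Complex.sub_re]
    rw [this] at hreal
    rw [neg_div]
    linarith
  rw [EReal.coe_ennreal_add, EReal.coe_ennreal_add, ← EReal.coe_ennreal_toReal hX,
    ← EReal.coe_ennreal_toReal hY, add_comm (P : EReal), ← add_assoc, ← add_assoc,
    ← EReal.coe_add, ← EReal.coe_add, hXY]

theorem lintegral_trace_symmQuotientPow_lt_top (hA : A.PosSemidef) (hB : B.PosSemidef) {α : ℝ}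
    (hα : 1 < α) (h : SuppLE A B) :
    ∫⁻ t in Set.Ioi (0 : ℝ), ENNReal.ofReal (symmQuotientPow α A B t).trace.re < ⊤ := by
  obtain ⟨c, hc⟩ := exists_posSemidef_smul_sub hA hB h
  rw [lintegral_trace_symmQuotientPow hA hB hα, lintegral_Ioi_zero_hockeyStick_eq_add, mul_add]
  refine ENNReal.add_lt_top.mpr ⟨?_, ENNReal.mul_lt_top ENNReal.ofReal_lt_top ?_⟩
  · have hadd := lintegral_Ioo_hockeyStick_add hA hB hα
    have hY := (lintegral_Ioi_one_hockeyStick_le hA hB hα).trans_lt ENNReal.ofReal_lt_top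
    exact (le_self_add.trans_eq hadd).trans_lt (ENNReal.add_lt_top.mpr ⟨ENNReal.ofReal_lt_top, hY⟩)
  · calc ∫⁻ γ in Set.Ioi (1 : ℝ), ENNReal.ofReal (γ ^ (α - 2) * hockeyStick γ A B)
        ≤ ∫⁻ γ in Set.Ioi (1 : ℝ), (Set.Iic c).indicator
            (fun _ => ENNReal.ofReal (c ^ α * A.trace.re)) γ := by
          refine setLIntegral_mono' measurableSet_Ioi fun γ hγ => ?_
          have hγ1 : (1 : ℝ) < γ := hγ
          have hγ0 : (0 : ℝ) < γ := one_pos.trans hγ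
          by_cases hγc : γ ≤ c
          · rw [Set.indicator_of_mem (Set.mem_Iic.mpr hγc)]
            refine ENNReal.ofReal_le_ofReal (mul_le_mul ?_ (hockeyStick_le_trace hA hB hγ0.le)
              (hockeyStick_nonneg hA hB γ) (Real.rpow_nonneg (hγ0.le.trans hγc) _))
            exact (Real.rpow_le_rpow_of_exponent_le hγ1.le (by linarith)).trans
              (Real.rpow_le_rpow hγ0.le hγc (by linarith))
          · simp [hockeyStick_eq_zero hA hB hc (le_of_not_ge hγc)]
      _ = ENNReal.ofReal (c ^ α * A.trace.re) * volume (Set.Ioc 1 c) := by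
          rw [lintegral_indicator_const measurableSet_Iic, Measure.restrict_apply measurableSet_Iic,
            Set.inter_comm, Set.Ioi_inter_Iic]
      _ < ⊤ := ENNReal.mul_lt_top ENNReal.ofReal_lt_top measure_Ioc_lt_top

end TraceIntegral

end QuantumRenyi

theorem theorem4p4 {n : Type*} [Fintype n] [DecidableEq n] (A B : Matrix n n ℂ)
    (hA : A.PosSemidef) (hB : B.PosSemidef) (α : ℝ) (hα : 1 < α) :
    -- the integrands are nonnegative real numbers
    (∀ t : ℝ, 0 < t →
      0 ≤ (QuantumRenyi.quotientPow α A B t).trace ∧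
      0 ≤ (QuantumRenyi.symmQuotientPow α A B t).trace) ∧
    -- the trace expression for the Hellinger divergence, in `(-∞, ∞]`
    QuantumRenyi.hellinger α A B =
      ((-1 / (α - 1) * A.trace.re : ℝ) : EReal) +
        ((∫⁻ t in Set.Ioi (0 : ℝ),
          ENNReal.ofReal (QuantumRenyi.quotientPow α A B t).trace.re : ENNReal) : EReal) ∧
    -- its form for the quasi Rényi divergence
    QuantumRenyi.quasiRenyi α A B =
      ((1 - A.trace.re : ℝ) : EReal) + ((α - 1 : ℝ) : EReal) *
        ((∫⁻ t in Set.Ioi (0 : ℝ),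
          ENNReal.ofReal (QuantumRenyi.symmQuotientPow α A B t).trace.re : ENNReal) : EReal) ∧
    (A.trace = 1 →
      QuantumRenyi.quasiRenyi α A B = ((α - 1 : ℝ) : EReal) *
        ((∫⁻ t in Set.Ioi (0 : ℝ),
          ENNReal.ofReal (QuantumRenyi.symmQuotientPow α A B t).trace.re : ENNReal) : EReal)) ∧
    -- the integral converges if `A ≪ B`
    (QuantumRenyi.SuppLE A B →
      (∫⁻ t in Set.Ioi (0 : ℝ),
        ENNReal.ofReal (QuantumRenyi.quotientPow α A B t).trace.re) < ⊤) := by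
  have hα1 : 0 < α - 1 := sub_pos.mpr hα
  have hint : ∫⁻ t in Set.Ioi (0 : ℝ),
        ENNReal.ofReal (QuantumRenyi.quotientPow α A B t).trace.re =
      ∫⁻ t in Set.Ioi (0 : ℝ),
        ENNReal.ofReal (QuantumRenyi.symmQuotientPow α A B t).trace.re :=
    MeasureTheory.setLIntegral_congr_fun measurableSet_Ioi fun t ht => by
      simp only [QuantumRenyi.trace_quotientPow hA hB α ht]
  have hH := QuantumRenyi.hellinger_eq_trace_integral hA hB hα
  have hQ : QuantumRenyi.quasiRenyi α A B =
      ((1 - A.trace.re : ℝ) : EReal) + ((α - 1 : ℝ) : EReal) *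
        ((∫⁻ t in Set.Ioi (0 : ℝ),
          ENNReal.ofReal (QuantumRenyi.symmQuotientPow α A B t).trace.re : ENNReal) : EReal) := by
    rw [QuantumRenyi.quasiRenyi, hH, EReal.left_distrib_of_nonneg_of_ne_top
      (by exact_mod_cast hα1.le) (EReal.coe_ne_top _), ← EReal.coe_mul, ← add_assoc,
      ← EReal.coe_one, ← EReal.coe_add]
    congr 3
    field_simp
  refine ⟨fun t ht => ?_, by rw [hint, hH], hQ, fun h1 => ?_, fun h => ?_⟩
  · have hM := QuantumRenyi.symmQuotient_posSemidef hA hB ht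
    have h0 : 0 ≤ (QuantumRenyi.symmQuotientPow α A B t).trace := by
      rw [QuantumRenyi.trace_symmQuotientPow α hM.isHermitian]
      exact_mod_cast Finset.sum_nonneg fun i _ => Real.rpow_nonneg (hM.eigenvalues_nonneg i) α
    exact ⟨(QuantumRenyi.trace_quotientPow hA hB α ht).symm ▸ h0, h0⟩
  · rw [hQ, h1]
    simp
  · rw [hint]
    exact QuantumRenyi.lintegral_trace_symmQuotientPow_lt_top hA hB hα h
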